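/- Let $A=(A_1,\dots,A_N)$ be a vector of non-negative real random variables on a probability space $(\Omega,\mathcal F,P)$ such that \[ P\Big\{\sum_{i=1}^N \mathbf 1\{A_i>0\}\in\{0,1\}\Big\}<1,\qquad \mathbb E\Big[\sum_{i=1}^N \mathbf 1\{A_i>0\}\Big]>1,\qquad P\{A_i\in\{0,1\}\ \text{for all } i=1,\dots,N\}<1 . \] Let $F_0$ be the distribution function, and $\phi_0$ the characteristic function, of a probability measure on $\mathbb R$. Let $\phi(t,\xi)$, $t\ge 0$, $\xi\in\mathbb R$, be the solution of \[ \partial_t\phi(t,\xi)+\phi(t,\xi)=\mathbb E\Big[\prod_{i=1}^N\phi(t,A_i\xi)\Big]\quad(t>0,\ \xi\in\mathbb R),\qquad \phi(0,\xi)=\phi_0(\xi), \] that is, a function such that $\phi(t,\cdot)$ is the characteristic function of a probability measure for every $t\ge0$, $t\mapsto\phi(t,\xi)$ is differentiable for $t>0$ and continuous at $t=0$ for every $\xi$, and the equation and the initial condition hold. For $s>0$ define $\mathcal S(s)=\mathbb E\big[\sum_{j=1}^N A_j^s\big]-1\in[-1,\infty]$ and $\mu(s)=\mathcal S(s)/s$.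 Let $\gamma\in(0,2]$ and assume that $F_0$ satisfies the following condition: - if $\gamma=1$: either $\int_{\mathbb R}|v|\,dF_0(v)<\infty$, or $F_0$ is symmetric and there is $c_0^+\in(0,\infty)$ with $\lim_{x\to+\infty}x(1-F_0(x))=\lim_{x\to-\infty}|x|F_0(x)=c_0^+$; - if $\gamma=2$: $0<\int_{\mathbb R}v^2\,dF_0(v)<\infty$ and $\int_{\mathbb R}v\,dF_0(v)=0$; - if $\gamma\in(0,1)\cup(1,2)$: $\lim_{x\to+\infty}x^\gamma(1-F_0(x))=c_0^+<\infty$ and $\lim_{x\to-\infty}|x|^\gamma F_0(x)=c_0^-<\infty$ with $c_0^++c_0^->0$, and, in addition, $\int_{\mathbb R}v\,dF_0(v)=0$ if $\gamma>1$. If $\mu(\delta)<\mu(\gamma)<\infty$ for some $0<\delta<\gamma$, then \[ \lim_{t\to+\infty}\phi\big(t,e^{-\mu(\gamma)t}\xi\big)=1\qquad\text{for every }\xi\in\mathbb R . \] -/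

import Mathlib

open MeasureTheory ProbabilityTheory Filter Topology Set

open scoped ENNReal

namespace KacLike

/-- The smoothing transformation
`Q̂(φ₁, …, φ_N)(ξ) = E[φ₁(A₁ ξ) ⋯ φ_N(A_N ξ)]`. -/
noncomputable def smoothing {Ω : Type*} [MeasurableSpace Ω] (P : Measure Ω) {N : ℕ}
    (A : Fin N → Ω → ℝ) (φ : Fin N → ℝ → ℂ) (ξ : ℝ) : ℂ :=
  ∫ ω, ∏ i, φ i (A i ω * ξ) ∂P

/-- `φ(t, ξ)`, `t ≥ 0`, is a solution of the Kac-like equation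
`∂ₜ φ(t, ξ) + φ(t, ξ) = Q̂(φ(t, ·), …, φ(t, ·))(ξ)` for `t > 0`, `ξ ∈ ℝ`,
with initial condition `φ(0, ·) = φ₀`, the characteristic function of `ρ₀`.
Every `φ(t, ·)` is the characteristic function of a probability measure `ρ_t`,
and `t ↦ φ(t, ξ)` is continuous up to `t = 0`. -/
structure IsSolution {Ω : Type*} [MeasurableSpace Ω] (P : Measure Ω) {N : ℕ}
    (A : Fin N → Ω → ℝ) (ρ₀ : Measure ℝ) (φ : ℝ → ℝ → ℂ) : Prop where
  isCharFun : ∀ t, 0 ≤ t → ∃ ρ : Measure ℝ, IsProbabilityMeasure ρ ∧ φ t = charFun ρ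
  initial : ∀ ξ, φ 0 ξ = charFun ρ₀ ξ
  continuous_zero : ∀ ξ, ContinuousWithinAt (fun t => φ t ξ) (Ici 0) 0
  differentiable : ∀ t, 0 < t → ∀ ξ, DifferentiableAt ℝ (fun s => φ s ξ) t
  equation : ∀ t, 0 < t → ∀ ξ,
    deriv (fun s => φ s ξ) t + φ t ξ = smoothing P A (fun _ => φ t) ξ

/-- The number of indices `i` with `A_i > 0`. -/
noncomputable def numPos {Ω : Type*} {N : ℕ} (A : Fin N → Ω → ℝ) (ω : Ω) : ℕ :=
  (Finset.univ.filter fun i => 0 < A i ω).card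

/-- The non-degeneracy assumptions on the weights. -/
structure WeightHyp {Ω : Type*} [MeasurableSpace Ω] (P : Measure Ω) {N : ℕ}
    (A : Fin N → Ω → ℝ) : Prop where
  count_lt : P {ω | numPos A ω ∈ ({0, 1} : Set ℕ)} < 1
  mean_count : 1 < ∫ ω, (numPos A ω : ℝ) ∂P
  not_zero_one : P {ω | ∀ i, A i ω = 0 ∨ A i ω = 1} < 1

/-- The power `a ^ s` with the convention `0 ^ 0 = 0`. -/
noncomputable def powZ (a s : ℝ) : ℝ := if a = 0 then 0 else a ^ s

/-- `𝒮(s) = E[∑ⱼ Aⱼ ^ s] - 1`, with values in `[-1, ∞]`. -/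
noncomputable def convexS {Ω : Type*} [MeasurableSpace Ω] (P : Measure Ω) {N : ℕ}
    (A : Fin N → Ω → ℝ) (s : ℝ) : EReal :=
  ((∫⁻ ω, ∑ j, ENNReal.ofReal (powZ (A j ω) s) ∂P : ℝ≥0∞) : EReal) - 1

/-- The spectral function `μ(s) = 𝒮(s) / s`, for `s > 0`, with values in `(-∞, ∞]`. -/
noncomputable def spectral {Ω : Type*} [MeasurableSpace Ω] (P : Measure Ω) {N : ℕ}
    (A : Fin N → Ω → ℝ) (s : ℝ) : EReal :=
  convexS P A s / (s : EReal)

/-- `lim_{x → +∞} x ^ γ (1 - F₀(x)) = cp` and `lim_{x → -∞} |x| ^ γ F₀(x) = cm`, where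
`F₀` is the distribution function of `ρ₀`. -/
def TailCondition (γ : ℝ) (ρ₀ : Measure ℝ) (cp cm : ℝ) : Prop :=
  Tendsto (fun x : ℝ => x ^ γ * (1 - cdf ρ₀ x)) atTop (𝓝 cp) ∧
    Tendsto (fun x : ℝ => |x| ^ γ * cdf ρ₀ x) atBot (𝓝 cm)

/-- The hypothesis for `γ = 1`: finite first absolute moment, or symmetry together with the
tail condition of exponent `1` with a positive constant. -/
def HypOne (ρ₀ : Measure ℝ) : Prop :=
  Integrable (fun v : ℝ => v) ρ₀ ∨
    (ρ₀.map (fun v : ℝ => -v) = ρ₀ ∧ ∃ c : ℝ, 0 < c ∧ TailCondition 1 ρ₀ c c)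

/-- The hypothesis for `γ = 2`: centered, with finite and positive variance. -/
def HypTwo (ρ₀ : Measure ℝ) : Prop :=
  Integrable (fun v : ℝ => v ^ 2) ρ₀ ∧ 0 < ∫ v, v ^ 2 ∂ρ₀ ∧ ∫ v, v ∂ρ₀ = 0

/-- The hypothesis for `γ ∈ (0, 1) ∪ (1, 2)`. -/
def HypStable (γ : ℝ) (ρ₀ : Measure ℝ) : Prop :=
  (∃ cp cm : ℝ, 0 < cp + cm ∧ TailCondition γ ρ₀ cp cm) ∧
    (1 < γ → Integrable (fun v : ℝ => v) ρ₀ ∧ ∫ v, v ∂ρ₀ = 0)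

/-- The hypothesis on the initial law, for `γ ∈ (0, 2]`. -/
def HypGamma (γ : ℝ) (ρ₀ : Measure ℝ) : Prop :=
  (γ = 1 → HypOne ρ₀) ∧ (γ = 2 → HypTwo ρ₀) ∧ (γ ∈ Ioo 0 1 ∪ Ioo 1 2 → HypStable γ ρ₀)

end KacLike

/-!
A finite moment of order `δ ≤ 2` (with mean zero if `δ > 1`) gives `|φ₀(ξ) - 1| ≤ C |ξ| ^ δ`.
Since a product of numbers in the unit disc is at least as close to `1` as its factors are in total,
the equation propagates this to `|φ(t, ξ) - 1| ≤ C |ξ| ^ δ exp (δ μ(δ) t)`: Picard iteration of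
the resulting differential inequality, started from the trivial bound `2`, leaves the error
`2 (N t) ^ n / n!` after `n` steps. At `e^{-μ(γ) t} ξ` the bound is
`C |ξ| ^ δ exp (-δ (μ(γ) - μ(δ)) t)`, which tends to `0`.
-/

namespace KacLike

section Comparison

lemma norm_le_of_norm_deriv_add_le {E : Type*} [NormedAddCommGroup E] [NormedSpace ℝ E]
    {u u' : ℝ → E} {B B' : ℝ → ℝ} {a b : ℝ} (hab : a ≤ b)
    (hu : ContinuousOn u (Icc a b)) (hu' : ∀ x ∈ Ioo a b, HasDerivAt u (u' x) x)
    (hB : ContinuousOn B (Icc a b)) (hB' : ∀ x ∈ Ioo a b, HasDerivAt B (B' x) x)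
    (ha : ‖u a‖ ≤ B a) (bound : ∀ x ∈ Ioo a b, ‖u' x + u x‖ ≤ B' x + B x) :
    ‖u b‖ ≤ B b := by
  -- Testing against a norming functional `g` of `u b` makes the problem scalar; `exp` is the
  -- integrating factor.
  obtain ⟨g, hg, hgb⟩ := exists_dual_vector'' ℝ (u b)
  have hg_le (x : E) : g x ≤ ‖x‖ := by
    simpa using (le_abs_self (g x)).trans (g.le_of_opNorm_le hg x)
  have hmono : MonotoneOn (fun x => Real.exp x * (B x - g (u x))) (Icc a b) := by
    refine monotoneOn_of_hasDerivWithinAt_nonneg (convex_Icc a b)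
      (f' := fun x => Real.exp x * (B x - g (u x)) + Real.exp x * (B' x - g (u' x)))
      (by fun_prop) (fun x hx => ?_) (fun x hx => ?_) <;> rw [interior_Icc] at hx
    · exact ((Real.hasDerivAt_exp x).mul
        ((hB' x hx).sub (g.hasFDerivAt.comp_hasDerivAt x (hu' x hx)))).hasDerivWithinAt
    · have hx' : g (u' x) + g (u x) ≤ B' x + B x :=
        (map_add g _ _).symm.trans_le ((hg_le _).trans (bound x hx))
      rw [← mul_add]
      exact mul_nonneg (Real.exp_pos x).le (by linarith)
  have hnonneg : 0 ≤ Real.exp b * (B b - g (u b)) :=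
    (mul_nonneg (Real.exp_pos a).le (sub_nonneg.2 ((hg_le _).trans ha))).trans
      (hmono (left_mem_Icc.2 hab) (right_mem_Icc.2 hab) hab)
  have hb : g (u b) ≤ B b := sub_nonneg.1 (nonneg_of_mul_nonneg_right hnonneg (Real.exp_pos b))
  simpa [hgb] using hb

lemma hasDerivAt_mul_pow_succ_div_factorial (c : ℝ) (n : ℕ) (t : ℝ) :
    HasDerivAt (fun s => (c * s) ^ (n + 1) / (n + 1).factorial)
      (c * ((c * t) ^ n / n.factorial)) t := by
  refine ((((hasDerivAt_id t).const_mul c).pow (n + 1)).div_const _).congr_deriv ?_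
  simp only [Nat.factorial_succ, id]
  push_cast
  field_simp

end Comparison

section Smoothing

lemma norm_prod_sub_one_le {ι R : Type*} [SeminormedCommRing R] (s : Finset ι) {z : ι → R}
    (hz : ∀ i ∈ s, ‖z i‖ ≤ 1) : ‖∏ i ∈ s, z i - 1‖ ≤ ∑ i ∈ s, ‖z i - 1‖ := by
  classical
  induction s using Finset.induction_on with
  | empty => simp
  | insert a s ha ih =>
    have hsplit : z a * ∏ i ∈ s, z i - 1 = (z a - 1) + z a * (∏ i ∈ s, z i - 1) := by ring
    have ha1 : ‖z a‖ ≤ 1 := hz a (Finset.mem_insert_self a s)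
    rw [Finset.prod_insert ha, Finset.sum_insert ha, hsplit]
    refine norm_add_le_of_le le_rfl ((norm_mul_le _ _).trans ?_)
    exact (mul_le_of_le_one_left (norm_nonneg _) ha1).trans
      (ih fun i hi => hz i (Finset.mem_insert_of_mem hi))

/-- The moment `E[∑ⱼ Aⱼ ^ s] = 𝒮(s) + 1` as a real number; it is `0` when the sum is not
integrable, so it is only used together with integrability. -/
noncomputable def sumMoment {Ω : Type*} [MeasurableSpace Ω] (P : Measure Ω) {N : ℕ}
    (A : Fin N → Ω → ℝ) (s : ℝ) : ℝ :=
  ∫ ω, ∑ i, A i ω ^ s ∂P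

variable {Ω : Type*} [MeasurableSpace Ω] {P : Measure Ω} [IsProbabilityMeasure P] {N : ℕ}
  {A : Fin N → Ω → ℝ}

lemma norm_smoothing_sub_one_le_integral (hA : ∀ i, AEMeasurable (A i) P)
    {ψ : Fin N → ℝ → ℂ} (hψ : ∀ i, Measurable (ψ i)) (hψ1 : ∀ i x, ‖ψ i x‖ ≤ 1) (ξ : ℝ) :
    ‖smoothing P A ψ ξ - 1‖ ≤ ∫ ω, ∑ i, ‖ψ i (A i ω * ξ) - 1‖ ∂P := by
  have hmeas (i : Fin N) : AEMeasurable (fun ω => ψ i (A i ω * ξ)) P :=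
    (hψ i).comp_aemeasurable ((hA i).mul_const ξ)
  have hprod : Integrable (fun ω => ∏ i, ψ i (A i ω * ξ)) P := by
    refine .of_bound (Finset.aemeasurable_fun_prod _ fun i _ => hmeas i).aestronglyMeasurable 1
      (ae_of_all _ fun ω => ?_)
    rw [norm_prod]
    exact Finset.prod_le_one (fun _ _ => norm_nonneg _) fun i _ => hψ1 i _
  have hsum : Integrable (fun ω => ∑ i, ‖ψ i (A i ω * ξ) - 1‖) P :=
    integrable_finsetSum _ fun i _ => ((Integrable.of_bound (hmeas i).aestronglyMeasurable 1
      (ae_of_all _ fun ω => hψ1 i _)).sub (integrable_const 1)).norm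
  calc ‖smoothing P A ψ ξ - 1‖
      = ‖∫ ω, (∏ i, ψ i (A i ω * ξ) - 1) ∂P‖ := by
        rw [integral_sub hprod (integrable_const 1)]
        simp [smoothing]
    _ ≤ ∫ ω, ∑ i, ‖ψ i (A i ω * ξ) - 1‖ ∂P :=
        norm_integral_le_of_norm_le hsum
          (ae_of_all _ fun ω => norm_prod_sub_one_le _ fun i _ => hψ1 i _)

lemma norm_smoothing_sub_one_le (hA : ∀ i, AEMeasurable (A i) P)
    (hA_nonneg : ∀ᵐ ω ∂P, ∀ i, 0 ≤ A i ω) {δ : ℝ}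
    (hint : Integrable (fun ω => ∑ i, A i ω ^ δ) P) {ψ : Fin N → ℝ → ℂ}
    (hψ : ∀ i, Measurable (ψ i)) (hψ1 : ∀ i x, ‖ψ i x‖ ≤ 1) {K R : ℝ}
    (h : ∀ i x, ‖ψ i x - 1‖ ≤ K * |x| ^ δ + R) (ξ : ℝ) :
    ‖smoothing P A ψ ξ - 1‖ ≤ K * |ξ| ^ δ * sumMoment P A δ + N * R := by
  have hpt : ∀ᵐ ω ∂P, ∑ i, ‖ψ i (A i ω * ξ) - 1‖ ≤
      K * |ξ| ^ δ * ∑ i, A i ω ^ δ + N * R := by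
    filter_upwards [hA_nonneg] with ω hω
    calc ∑ i, ‖ψ i (A i ω * ξ) - 1‖
        ≤ ∑ i, (K * |ξ| ^ δ * A i ω ^ δ + R) := by
          refine Finset.sum_le_sum fun i _ => (h i _).trans_eq ?_
          rw [abs_mul, abs_of_nonneg (hω i), Real.mul_rpow (hω i) (abs_nonneg ξ)]
          ring
      _ = K * |ξ| ^ δ * ∑ i, A i ω ^ δ + N * R := by
          simp [Finset.sum_add_distrib, Finset.mul_sum]
  calc ‖smoothing P A ψ ξ - 1‖
      ≤ ∫ ω, ∑ i, ‖ψ i (A i ω * ξ) - 1‖ ∂P := norm_smoothing_sub_one_le_integral hA hψ hψ1 ξ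
    _ ≤ ∫ ω, (K * |ξ| ^ δ * ∑ i, A i ω ^ δ + N * R) ∂P :=
        integral_mono_of_nonneg (ae_of_all _ fun ω => by positivity)
          ((hint.const_mul _).add (integrable_const _)) hpt
    _ = K * |ξ| ^ δ * sumMoment P A δ + N * R := by
        rw [integral_add (hint.const_mul _) (integrable_const _), integral_const_mul]
        simp [sumMoment]

end Smoothing

section Evolution

variable {Ω : Type*} [MeasurableSpace Ω] {P : Measure Ω} {N : ℕ}
  {A : Fin N → Ω → ℝ} {ρ₀ : Measure ℝ} {φ : ℝ → ℝ → ℂ}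

lemma IsSolution.continuousOn (hφ : IsSolution P A ρ₀ φ) (ξ : ℝ) :
    ContinuousOn (fun t => φ t ξ) (Ici 0) := by
  intro t ht
  rcases (mem_Ici.1 ht).eq_or_lt with rfl | ht
  · exact hφ.continuous_zero ξ
  · exact (hφ.differentiable t ht ξ).continuousAt.continuousWithinAt

lemma IsSolution.norm_sub_one_le_of_norm_smoothing_sub_one_le (hφ : IsSolution P A ρ₀ φ)
    {B B' : ℝ → ℝ} {ξ : ℝ} (hB : ∀ t, HasDerivAt B (B' t) t) (h0 : ‖charFun ρ₀ ξ - 1‖ ≤ B 0)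
    (h : ∀ t, 0 < t → ‖smoothing P A (fun _ => φ t) ξ - 1‖ ≤ B' t + B t) {t : ℝ} (ht : 0 ≤ t) :
    ‖φ t ξ - 1‖ ≤ B t := by
  refine norm_le_of_norm_deriv_add_le (u := fun s => φ s ξ - 1) ht
    (((hφ.continuousOn ξ).mono Icc_subset_Ici_self).sub continuousOn_const)
    (fun s hs => (hφ.differentiable s hs.1 ξ).hasDerivAt.sub_const 1)
    (fun s _ => (hB s).continuousAt.continuousWithinAt) (fun s _ => hB s)
    (by rwa [hφ.initial]) (fun s hs => ?_)
  rw [add_sub_assoc', hφ.equation s hs.1 ξ]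
  exact h s hs.1

variable [IsProbabilityMeasure P]

/- One step of Picard iteration for the error `r`; the term `C |ξ| ^ δ exp ((E[∑ᵢ Aᵢ ^ δ] - 1) t)`
is an exact solution of the comparison equation and is reproduced unchanged. -/
lemma IsSolution.norm_sub_one_le_add_of_forall_le_add (hφ : IsSolution P A ρ₀ φ)
    (hA : ∀ i, AEMeasurable (A i) P) (hA_nonneg : ∀ᵐ ω ∂P, ∀ i, 0 ≤ A i ω) {δ C : ℝ}
    (hint : Integrable (fun ω => ∑ i, A i ω ^ δ) P)
    (h0 : ∀ ξ, ‖charFun ρ₀ ξ - 1‖ ≤ C * |ξ| ^ δ) {r R R' : ℝ → ℝ}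
    (h : ∀ t, 0 ≤ t → ∀ ξ,
      ‖φ t ξ - 1‖ ≤ C * |ξ| ^ δ * Real.exp ((sumMoment P A δ - 1) * t) + r t)
    (hR : ∀ t, HasDerivAt R (R' t) t) (hR0 : 0 ≤ R 0)
    (hrR : ∀ t, 0 < t → N * r t ≤ R' t + R t) {t : ℝ} (ht : 0 ≤ t) (ξ : ℝ) :
    ‖φ t ξ - 1‖ ≤ C * |ξ| ^ δ * Real.exp ((sumMoment P A δ - 1) * t) + R t := by
  set M := sumMoment P A δ
  have hexp (s : ℝ) : HasDerivAt (fun s => Real.exp ((M - 1) * s))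
      (Real.exp ((M - 1) * s) * (M - 1)) s := by
    simpa using ((hasDerivAt_id s).const_mul (M - 1)).exp
  refine hφ.norm_sub_one_le_of_norm_smoothing_sub_one_le
    (B := fun s => C * |ξ| ^ δ * Real.exp ((M - 1) * s) + R s)
    (fun s => ((hexp s).const_mul _).add (hR s)) ?_ (fun s hs => ?_) ht
  · simpa using add_le_add (h0 ξ) hR0
  · obtain ⟨ρ, hρ, hφs⟩ := hφ.isCharFun s hs.le
    have hsmooth : ‖smoothing P A (fun _ => φ s) ξ - 1‖ ≤
        C * Real.exp ((M - 1) * s) * |ξ| ^ δ * M + N * r s :=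
      norm_smoothing_sub_one_le hA hA_nonneg hint
        (fun _ => hφs ▸ continuous_charFun.measurable) (fun _ _ => hφs ▸ norm_charFun_le_one _)
        (fun _ x => (h s hs.le x).trans_eq (by ring)) ξ
    linear_combination hsmooth + hrR s hs

lemma IsSolution.norm_sub_one_le_add_pow_div_factorial (hφ : IsSolution P A ρ₀ φ)
    (hA : ∀ i, AEMeasurable (A i) P) (hA_nonneg : ∀ᵐ ω ∂P, ∀ i, 0 ≤ A i ω) {δ C : ℝ}
    (hint : Integrable (fun ω => ∑ i, A i ω ^ δ) P)
    (h0 : ∀ ξ, ‖charFun ρ₀ ξ - 1‖ ≤ C * |ξ| ^ δ) (n : ℕ) {t : ℝ} (ht : 0 ≤ t) (ξ : ℝ) :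
    ‖φ t ξ - 1‖ ≤ C * |ξ| ^ δ * Real.exp ((sumMoment P A δ - 1) * t)
      + 2 * ((N * t) ^ n / n.factorial) := by
  induction n generalizing t ξ with
  | zero =>
    obtain ⟨ρ, hρ, hφt⟩ := hφ.isCharFun t ht
    have htwo : ‖φ t ξ - 1‖ ≤ 2 := by
      rw [hφt, norm_sub_rev]
      exact norm_one_sub_charFun_le_two
    have hnonneg : 0 ≤ C * |ξ| ^ δ := (norm_nonneg _).trans (h0 ξ)
    simpa using htwo.trans (le_add_of_nonneg_left (mul_nonneg hnonneg (Real.exp_pos _).le))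
  | succ n ih =>
    refine hφ.norm_sub_one_le_add_of_forall_le_add hA hA_nonneg hint h0 (fun s hs ξ => ih hs ξ)
      (R := fun s => 2 * ((N * s) ^ (n + 1) / (n + 1).factorial))
      (fun s => (hasDerivAt_mul_pow_succ_div_factorial N n s).const_mul 2) (by simp)
      (fun s hs => ?_) ht ξ
    rw [mul_left_comm]
    exact le_add_of_nonneg_right (by positivity)

lemma IsSolution.norm_sub_one_le (hφ : IsSolution P A ρ₀ φ)
    (hA : ∀ i, AEMeasurable (A i) P) (hA_nonneg : ∀ᵐ ω ∂P, ∀ i, 0 ≤ A i ω) {δ C : ℝ}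
    (hint : Integrable (fun ω => ∑ i, A i ω ^ δ) P)
    (h0 : ∀ ξ, ‖charFun ρ₀ ξ - 1‖ ≤ C * |ξ| ^ δ) {t : ℝ} (ht : 0 ≤ t) (ξ : ℝ) :
    ‖φ t ξ - 1‖ ≤ C * |ξ| ^ δ * Real.exp ((sumMoment P A δ - 1) * t) := by
  have hlim := ((FloorSemiring.tendsto_pow_div_factorial_atTop (N * t)).const_mul 2).const_add
    (C * |ξ| ^ δ * Real.exp ((sumMoment P A δ - 1) * t))
  rw [mul_zero, add_zero] at hlim
  exact ge_of_tendsto' hlim fun n =>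
    hφ.norm_sub_one_le_add_pow_div_factorial hA hA_nonneg hint h0 n ht ξ

lemma IsSolution.tendsto_one (hφ : IsSolution P A ρ₀ φ)
    (hA : ∀ i, AEMeasurable (A i) P) (hA_nonneg : ∀ᵐ ω ∂P, ∀ i, 0 ≤ A i ω) {δ C m : ℝ}
    (hint : Integrable (fun ω => ∑ i, A i ω ^ δ) P)
    (h0 : ∀ ξ, ‖charFun ρ₀ ξ - 1‖ ≤ C * |ξ| ^ δ) (hm : sumMoment P A δ - 1 < m * δ) (ξ : ℝ) :
    Tendsto (fun t => φ t (Real.exp (-(t * m)) * ξ)) atTop (𝓝 1) := by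
  have hbound (t : ℝ) (ht : 0 ≤ t) : ‖φ t (Real.exp (-(t * m)) * ξ) - 1‖ ≤
      C * |ξ| ^ δ * Real.exp ((sumMoment P A δ - 1 - m * δ) * t) := by
    have hscale : |Real.exp (-(t * m)) * ξ| ^ δ = Real.exp (-(m * δ) * t) * |ξ| ^ δ := by
      rw [abs_mul, Real.abs_exp, Real.mul_rpow (Real.exp_pos _).le (abs_nonneg ξ), ← Real.exp_mul]
      ring_nf
    refine (hφ.norm_sub_one_le hA hA_nonneg hint h0 ht _).trans_eq ?_
    rw [hscale, sub_eq_add_neg _ (m * δ), add_mul, Real.exp_add]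
    ring
  have hlim : Tendsto (fun t => C * |ξ| ^ δ * Real.exp ((sumMoment P A δ - 1 - m * δ) * t))
      atTop (𝓝 0) := by
    simpa using (Real.tendsto_exp_atBot.comp
      (tendsto_id.const_mul_atTop_of_neg (sub_neg.2 hm))).const_mul (C * |ξ| ^ δ)
  refine tendsto_iff_norm_sub_tendsto_zero.2
    (squeeze_zero' (.of_forall fun t => norm_nonneg _) ?_ hlim)
  filter_upwards [eventually_ge_atTop 0] using hbound

end Evolution

section CharFun

lemma min_rpow_rpow_le_rpow {x a b δ : ℝ} (hx : 0 ≤ x) (haδ : a ≤ δ) (hδb : δ ≤ b)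
    (hb : 0 < b) : min (x ^ a) (x ^ b) ≤ x ^ δ := by
  rcases hx.eq_or_lt with rfl | hx
  · rw [Real.zero_rpow hb.ne']
    exact (min_le_right _ _).trans (Real.rpow_nonneg le_rfl δ)
  rcases le_total x 1 with h | h
  · exact (min_le_right _ _).trans (Real.rpow_le_rpow_of_exponent_ge hx h hδb)
  · exact (min_le_left _ _).trans (Real.rpow_le_rpow_of_exponent_le h haδ)

lemma norm_exp_mul_I_sub_one_le (x : ℝ) : ‖Complex.exp (x * Complex.I) - 1‖ ≤ |x| := by
  rw [mul_comm]
  exact Real.norm_exp_I_mul_ofReal_sub_one_le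

lemma norm_exp_mul_I_sub_one_le_two_mul_rpow {δ : ℝ} (hδ0 : 0 ≤ δ) (hδ1 : δ ≤ 1) (x : ℝ) :
    ‖Complex.exp (x * Complex.I) - 1‖ ≤ 2 * |x| ^ δ := by
  have hzero : ‖Complex.exp (x * Complex.I) - 1‖ ≤ 2 := by
    refine (norm_sub_le _ _).trans_eq ?_
    rw [Complex.norm_exp_ofReal_mul_I, norm_one]
    norm_num
  have hmin : ‖Complex.exp (x * Complex.I) - 1‖ ≤ 2 * min (|x| ^ (0 : ℝ)) (|x| ^ (1 : ℝ)) := by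
    rw [Real.rpow_zero, Real.rpow_one, mul_min_of_nonneg _ _ zero_le_two]
    exact le_min (by linarith) (by linarith [abs_nonneg x, norm_exp_mul_I_sub_one_le x])
  refine hmin.trans ?_
  gcongr
  exact min_rpow_rpow_le_rpow (abs_nonneg x) hδ0 hδ1 one_pos

lemma norm_exp_mul_I_sub_one_sub_le_two_mul_rpow {δ : ℝ} (hδ1 : 1 ≤ δ) (hδ2 : δ ≤ 2) (x : ℝ) :
    ‖Complex.exp (x * Complex.I) - 1 - x * Complex.I‖ ≤ 2 * |x| ^ δ := by
  have hx : ‖(x * Complex.I : ℂ)‖ = |x| := by simp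
  have hone : ‖Complex.exp (x * Complex.I) - 1 - x * Complex.I‖ ≤ 2 * |x| := by
    rw [two_mul]
    exact norm_sub_le_of_le (norm_exp_mul_I_sub_one_le x) hx.le
  have htwo : ‖Complex.exp (x * Complex.I) - 1 - x * Complex.I‖ ≤ 2 * |x| ^ 2 := by
    rcases le_total |x| 1 with h | h
    · have := Complex.norm_exp_sub_one_sub_id_le (hx.trans_le h)
      rw [hx] at this
      linarith [sq_nonneg |x|]
    · exact hone.trans (by gcongr; exact le_self_pow₀ h two_ne_zero)
  have hmin : ‖Complex.exp (x * Complex.I) - 1 - x * Complex.I‖ ≤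
      2 * min (|x| ^ (1 : ℝ)) (|x| ^ (2 : ℝ)) := by
    rw [Real.rpow_one, Real.rpow_two, mul_min_of_nonneg _ _ zero_le_two]
    exact le_min hone htwo
  refine hmin.trans ?_
  gcongr
  exact min_rpow_rpow_le_rpow (abs_nonneg x) hδ1 hδ2 two_pos

lemma norm_integral_comp_const_mul_le {E : Type*} [NormedAddCommGroup E] [NormedSpace ℝ E]
    {μ : Measure ℝ} {g : ℝ → E} {c δ : ℝ} (hg : ∀ x, ‖g x‖ ≤ c * |x| ^ δ)
    (hint : Integrable (fun v : ℝ => |v| ^ δ) μ) (ξ : ℝ) :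
    ‖∫ v, g (ξ * v) ∂μ‖ ≤ c * (∫ v, |v| ^ δ ∂μ) * |ξ| ^ δ := by
  refine (norm_integral_le_of_norm_le (hint.const_mul (c * |ξ| ^ δ))
    (ae_of_all _ fun v => (hg (ξ * v)).trans_eq ?_)).trans_eq ?_
  · rw [abs_mul, Real.mul_rpow (abs_nonneg ξ) (abs_nonneg v), mul_assoc]
  · rw [integral_const_mul, mul_right_comm]

lemma integrable_exp_mul_I {μ : Measure ℝ} [IsFiniteMeasure μ] (ξ : ℝ) :
    Integrable (fun v : ℝ => Complex.exp ((ξ * v : ℝ) * Complex.I)) μ :=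
  .of_bound (by fun_prop) 1 (ae_of_all _ fun v => (Complex.norm_exp_ofReal_mul_I (ξ * v)).le)

variable {μ : Measure ℝ} [IsProbabilityMeasure μ]

lemma charFun_sub_one_eq_integral (ξ : ℝ) :
    charFun μ ξ - 1 = ∫ v : ℝ, (Complex.exp ((ξ * v : ℝ) * Complex.I) - 1) ∂μ := by
  rw [integral_sub (integrable_exp_mul_I ξ) (integrable_const 1), charFun_apply_real]
  simp

lemma charFun_sub_one_eq_integral_of_integral_eq_zero (hint : Integrable (fun v : ℝ => v) μ)
    (hmean : ∫ v, v ∂μ = 0) (ξ : ℝ) :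
    charFun μ ξ - 1 =
      ∫ v : ℝ, (Complex.exp ((ξ * v : ℝ) * Complex.I) - 1 - (ξ * v : ℝ) * Complex.I) ∂μ := by
  have hexp : Integrable (fun v : ℝ => Complex.exp ((ξ * v : ℝ) * Complex.I) - 1) μ :=
    (integrable_exp_mul_I ξ).sub (integrable_const 1)
  have hlin : Integrable (fun v : ℝ => ((ξ * v : ℝ) * Complex.I : ℂ)) μ :=
    (hint.const_mul ξ).ofReal.mul_const Complex.I
  have hzero : ∫ v : ℝ, ((ξ * v : ℝ) * Complex.I : ℂ) ∂μ = 0 := by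
    rw [integral_mul_const, integral_complex_ofReal, integral_const_mul, hmean]
    simp
  rw [integral_sub hexp hlin, hzero, sub_zero, charFun_sub_one_eq_integral]

lemma norm_charFun_sub_one_le {δ : ℝ} (hδ0 : 0 ≤ δ) (hδ2 : δ ≤ 2)
    (hint : Integrable (fun v : ℝ => |v| ^ δ) μ) (hmean : 1 < δ → ∫ v, v ∂μ = 0) (ξ : ℝ) :
    ‖charFun μ ξ - 1‖ ≤ 2 * (∫ v, |v| ^ δ ∂μ) * |ξ| ^ δ := by
  rcases le_or_gt δ 1 with h1 | h1
  · rw [charFun_sub_one_eq_integral]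
    exact norm_integral_comp_const_mul_le
      (norm_exp_mul_I_sub_one_le_two_mul_rpow hδ0 h1) hint ξ
  · have hid : Integrable (fun v : ℝ => v) μ := by
      have h := integrable_norm_rpow_of_le aestronglyMeasurable_id zero_le_one hδ0 h1.le hint
      exact (integrable_norm_iff aestronglyMeasurable_id).1 (by simpa using h)
    rw [charFun_sub_one_eq_integral_of_integral_eq_zero hid (hmean h1)]
    exact norm_integral_comp_const_mul_le
      (norm_exp_mul_I_sub_one_sub_le_two_mul_rpow h1.le hδ2) hint ξ

end CharFun

section InitialLaw

lemma HypGamma.integral_eq_zero {ρ₀ : Measure ℝ} {γ : ℝ} (h : HypGamma γ ρ₀)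
    (hγ1 : 1 < γ) (hγ2 : γ ≤ 2) : ∫ v, v ∂ρ₀ = 0 := by
  rcases hγ2.eq_or_lt with h2 | h2
  · exact (h.2.1 h2).2.2
  · exact ((h.2.2 (Or.inr ⟨hγ1, h2⟩)).2 hγ1).2

lemma integrable_abs_rpow_of_isBigO_measureReal_lt_abs {Ω : Type*} [MeasurableSpace Ω]
    {μ : Measure Ω} [IsFiniteMeasure μ] {f : Ω → ℝ} (hf : AEMeasurable f μ) {γ δ : ℝ}
    (hδ : 0 < δ) (hδγ : δ < γ)
    (h : (fun x => μ.real {ω | x < |f ω|}) =O[atTop] fun x : ℝ => x ^ (-γ)) :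
    Integrable (fun ω => |f ω| ^ δ) μ := by
  have hanti : Antitone fun x => μ.real {ω | x < |f ω|} := fun x y hxy =>
    measureReal_mono fun ω (hω : y < |f ω|) => hxy.trans_lt hω
  have hbdd : (fun x => μ.real {ω | x < |f ω|}) =O[𝓝[>] 0] fun x : ℝ => x ^ (-0 : ℝ) := by
    simp only [neg_zero, Real.rpow_zero]
    refine .of_bound (μ.real univ) (.of_forall fun x => ?_)
    rw [Real.norm_of_nonneg measureReal_nonneg, norm_one, mul_one]
    exact measureReal_mono (subset_univ _)
  have hlayer : IntegrableOn (fun x => x ^ (δ - 1) * μ.real {ω | x < |f ω|}) (Ioi 0) :=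
    mellin_convergent_of_isBigO_scalar (hanti.locallyIntegrable.locallyIntegrableOn _) h hδγ
      hbdd hδ
  refine ⟨(hf.abs.pow_const δ).aestronglyMeasurable, ?_⟩
  rw [hasFiniteIntegral_iff_ofReal (ae_of_all _ fun ω => by positivity),
    lintegral_rpow_eq_lintegral_meas_lt_mul μ (ae_of_all _ fun ω => abs_nonneg _) hf.abs hδ]
  refine ENNReal.mul_lt_top ENNReal.ofReal_lt_top (lt_of_eq_of_lt ?_ hlayer.lintegral_lt_top)
  refine setLIntegral_congr_fun measurableSet_Ioi fun x (hx : 0 < x) => ?_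
  rw [ENNReal.ofReal_mul (by positivity), ofReal_measureReal, mul_comm]

variable {ρ₀ : Measure ℝ} [IsProbabilityMeasure ρ₀] {γ δ : ℝ}

lemma measureReal_lt_abs_le_cdf (x : ℝ) :
    ρ₀.real {v | x < |v|} ≤ (1 - cdf ρ₀ x) + cdf ρ₀ (-x) := by
  have hsub : {v : ℝ | x < |v|} ⊆ (Iic x)ᶜ ∪ Iic (-x) := fun v (hv : x < |v|) =>
    (lt_abs.1 hv).imp not_le.2 fun h => (lt_neg.1 h).le
  refine (measureReal_mono hsub).trans ((measureReal_union_le _ _).trans_eq ?_)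
  rw [probReal_compl_eq_one_sub measurableSet_Iic, cdf_eq_real, cdf_eq_real]

lemma TailCondition.isBigO_measureReal_lt_abs {cp cm : ℝ} (h : TailCondition γ ρ₀ cp cm) :
    (fun x => ρ₀.real {v | x < |v|}) =O[atTop] fun x : ℝ => x ^ (-γ) := by
  have hlim := h.1.add (h.2.comp tendsto_neg_atTop_atBot)
  have hbig := (hlim.isBigO_one ℝ).mul (Asymptotics.isBigO_refl (fun x : ℝ => x ^ (-γ)) atTop)
  simp only [one_mul] at hbig
  refine .trans (.of_bound' ?_) hbig
  filter_upwards [eventually_gt_atTop 0] with x hx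
  have hxγ : 0 < x ^ γ := Real.rpow_pos_of_pos hx γ
  rw [Real.norm_of_nonneg measureReal_nonneg]
  refine (measureReal_lt_abs_le_cdf x).trans ((le_of_eq ?_).trans (le_abs_self _))
  simp only [Function.comp_apply, abs_neg, abs_of_pos hx]
  rw [Real.rpow_neg hx.le, ← mul_add, ← div_eq_mul_inv, mul_div_cancel_left₀ _ hxγ.ne']

lemma TailCondition.integrable_abs_rpow {cp cm : ℝ} (h : TailCondition γ ρ₀ cp cm)
    (hδ : 0 < δ) (hδγ : δ < γ) : Integrable (fun v : ℝ => |v| ^ δ) ρ₀ :=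
  integrable_abs_rpow_of_isBigO_measureReal_lt_abs aemeasurable_id hδ hδγ
    h.isBigO_measureReal_lt_abs

lemma HypGamma.integrable_abs_rpow (h : HypGamma γ ρ₀) (hγ : γ ∈ Ioc (0 : ℝ) 2)
    (hδ : 0 < δ) (hδγ : δ < γ) : Integrable (fun v : ℝ => |v| ^ δ) ρ₀ := by
  have hmono (hi : Integrable (fun v : ℝ => |v| ^ γ) ρ₀) :
      Integrable (fun v : ℝ => |v| ^ δ) ρ₀ :=
    integrable_norm_rpow_of_le aestronglyMeasurable_id hδ.le hγ.1.le hδγ.le hi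
  by_cases h1 : γ = 1
  · rcases h.1 h1 with hi | ⟨-, c, -, hc⟩
    · exact hmono (by simpa [h1] using hi.abs)
    · exact hc.integrable_abs_rpow hδ (hδγ.trans_eq h1)
  by_cases h2 : γ = 2
  · exact hmono (by simpa [h2] using (h.2.1 h2).1)
  have hmem : γ ∈ Ioo (0 : ℝ) 1 ∪ Ioo 1 2 :=
    (lt_or_gt_of_ne h1).imp (fun h => ⟨hγ.1, h⟩) fun h => ⟨h, lt_of_le_of_ne hγ.2 h2⟩
  obtain ⟨⟨cp, cm, -, hc⟩, -⟩ := h.2.2 hmem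
  exact hc.integrable_abs_rpow hδ hδγ

end InitialLaw

section Spectral

variable {Ω : Type*} [MeasurableSpace Ω] {P : Measure Ω} {N : ℕ} {A : Fin N → Ω → ℝ} {s : ℝ}

lemma powZ_of_ne_zero (hs : s ≠ 0) (a : ℝ) : powZ a s = a ^ s := by
  rw [powZ, ite_eq_right_iff]
  rintro rfl
  exact (Real.zero_rpow hs).symm

lemma convexS_eq_lintegral (hA_nonneg : ∀ᵐ ω ∂P, ∀ i, 0 ≤ A i ω) (hs : s ≠ 0) :
    convexS P A s = ((∫⁻ ω, ENNReal.ofReal (∑ i, A i ω ^ s) ∂P : ℝ≥0∞) : EReal) - 1 := by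
  rw [convexS]
  congr 2
  refine lintegral_congr_ae ?_
  filter_upwards [hA_nonneg] with ω hω
  simp only [powZ_of_ne_zero hs]
  exact (ENNReal.ofReal_sum_of_nonneg fun i _ => Real.rpow_nonneg (hω i) s).symm

lemma sum_rpow_nonneg_ae (hA_nonneg : ∀ᵐ ω ∂P, ∀ i, 0 ≤ A i ω) :
    0 ≤ᵐ[P] fun ω => ∑ i, A i ω ^ s := by
  filter_upwards [hA_nonneg] with ω hω
  exact Finset.sum_nonneg fun i _ => Real.rpow_nonneg (hω i) s

lemma integrable_sum_rpow_of_spectral_ne_top (hA : ∀ i, AEMeasurable (A i) P)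
    (hA_nonneg : ∀ᵐ ω ∂P, ∀ i, 0 ≤ A i ω) (hs : 0 < s) (h : spectral P A s ≠ ⊤) :
    Integrable (fun ω => ∑ i, A i ω ^ s) P := by
  refine ⟨(Finset.aemeasurable_fun_sum _ fun i _ => (hA i).pow_const s).aestronglyMeasurable, ?_⟩
  rw [hasFiniteIntegral_iff_ofReal (sum_rpow_nonneg_ae hA_nonneg), lt_top_iff_ne_top]
  contrapose! h
  rw [spectral, convexS_eq_lintegral hA_nonneg hs.ne', h, EReal.coe_ennreal_top]
  exact EReal.top_div_of_pos_ne_top (EReal.coe_pos.2 hs) (EReal.coe_ne_top s)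

lemma spectral_eq_sumMoment (hA_nonneg : ∀ᵐ ω ∂P, ∀ i, 0 ≤ A i ω) (hs : s ≠ 0)
    (hint : Integrable (fun ω => ∑ i, A i ω ^ s) P) :
    spectral P A s = ((sumMoment P A s - 1) / s : ℝ) := by
  have hnonneg := sum_rpow_nonneg_ae (s := s) hA_nonneg
  rw [spectral, convexS_eq_lintegral hA_nonneg hs,
    ← ofReal_integral_eq_lintegral_ofReal hint hnonneg, EReal.coe_ennreal_ofReal,
    max_eq_left (integral_nonneg_of_ae hnonneg)]
  norm_cast

end Spectral

end KacLike

theorem theorem3_general {Ω : Type*} [MeasurableSpace Ω] (P : Measure Ω) [IsProbabilityMeasure P]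
    {N : ℕ} (A : Fin N → Ω → ℝ) (hA : ∀ i, AEMeasurable (A i) P)
    (hA_nonneg : ∀ᵐ ω ∂P, ∀ i, 0 ≤ A i ω)
    (ρ₀ : Measure ℝ) [IsProbabilityMeasure ρ₀] {δ : ℝ} (hδ : δ ∈ Ioc (0 : ℝ) 2)
    (hint : Integrable (fun v : ℝ => |v| ^ δ) ρ₀) (hmean : 1 < δ → ∫ v, v ∂ρ₀ = 0)
    {m : ℝ} (hm : KacLike.spectral P A δ < m)
    (φ : ℝ → ℝ → ℂ) (hφ : KacLike.IsSolution P A ρ₀ φ) (ξ : ℝ) :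
    Tendsto (fun t : ℝ => φ t (Real.exp (-(t * m)) * ξ)) atTop (𝓝 1) := by
  have hsum : Integrable (fun ω => ∑ i, A i ω ^ δ) P :=
    KacLike.integrable_sum_rpow_of_spectral_ne_top hA hA_nonneg hδ.1 hm.ne_top
  have hrate : KacLike.sumMoment P A δ - 1 < m * δ := by
    rwa [KacLike.spectral_eq_sumMoment hA_nonneg hδ.1.ne' hsum, EReal.coe_lt_coe_iff,
      div_lt_iff₀ hδ.1] at hm
  exact hφ.tendsto_one hA hA_nonneg hsum
    (KacLike.norm_charFun_sub_one_le hδ.1.le hδ.2 hint hmean) hrate ξ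

theorem theorem3 {Ω : Type*} [MeasurableSpace Ω] (P : Measure Ω) [IsProbabilityMeasure P]
    {N : ℕ} (A : Fin N → Ω → ℝ) (hA_meas : ∀ i, Measurable (A i))
    (hA_nonneg : ∀ᵐ ω ∂P, ∀ i, 0 ≤ A i ω) (hA : KacLike.WeightHyp P A)
    (ρ₀ : Measure ℝ) [IsProbabilityMeasure ρ₀]
    (γ : ℝ) (hγ : γ ∈ Ioc (0 : ℝ) 2) (hρ₀ : KacLike.HypGamma γ ρ₀)
    (hμ : ∃ δ : ℝ, 0 < δ ∧ δ < γ ∧ KacLike.spectral P A δ < KacLike.spectral P A γ)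
    (hμγ : KacLike.spectral P A γ < ⊤)
    (φ : ℝ → ℝ → ℂ) (hφ : KacLike.IsSolution P A ρ₀ φ) (ξ : ℝ) :
    Tendsto (fun t : ℝ => φ t (Real.exp (-(t * (KacLike.spectral P A γ).toReal)) * ξ))
      atTop (𝓝 1) := by
  obtain ⟨δ, hδ, hδγ, hlt⟩ := hμ
  exact theorem3_general P A (fun i => (hA_meas i).aemeasurable) hA_nonneg ρ₀
    ⟨hδ, hδγ.le.trans hγ.2⟩ (hρ₀.integrable_abs_rpow hγ hδ hδγ)
    (fun h1 => hρ₀.integral_eq_zero (h1.trans hδγ) hγ.2)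
    (by rwa [EReal.coe_toReal hμγ.ne hlt.ne_bot]) φ hφ ξ
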